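/- Let $\Gamma=\mathbb Z^2\rtimes_{-I}\mathbb Z$ be the group generated by $\mathbb Z^2$ and an element $t$ of infinite order with $txt^{-1}=-x$ for $x\in\mathbb Z^2$, and let $\psi\in\mathrm{Aut}(\Gamma)$ be given by $\psi(x)=\begin{pmatrix}2&1\\1&1\end{pmatrix}x$ for $x\in\mathbb Z^2$ and $\psi(t)=t$ (Arnold's cat map). Let $\ell$ be the word length function of $\Gamma$ with respect to a finite generating set (for instance $\{x_1,x_2,t\}$ with $x_1,x_2$ the standard basis of $\mathbb Z^2$). Let $\lambda$ be the left regular representation of $\Gamma$ on $\ell^2(\Gamma)$ and let $C^*_r(\Gamma)$ be the norm closure of $\lambda(C_c(\Gamma))$, where $C_c(\Gamma)$ is the convolution algebra of finitely supported functions. Let $M_\ell\delta_g=\ell(g)\delta_g$ on $C_c(\Gamma)\subset\ell^2(\Gamma)$. For $k\ge 1$ let $L^k_\ell:C^*_r(\Gamma)\to[0,\infty]$ be given by $L^k_\ell(\lambda(f))=\|[M_\ell,[M_\ell,\dots,[M_\ell,\lambda(f)]\dots]]\|$ ($k$ commutators) for $f\in C_c(\Gamma)$, and $L^k_\ell=+\infty$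 outside $\lambda(C_c(\Gamma))$. Denote again by $\psi$ the induced automorphism $\sum_g c_g\delta_g\mapsto\sum_g c_g\delta_{\psi(g)}$ of $C^*_r(\Gamma)$. For a subset $Y$ of a normed space $X$ and $\delta>0$ let $D(Y,\delta)$ be the least dimension of a finite-dimensional subspace $Z\subseteq X$ such that every $y\in Y$ satisfies $\|y-z\|<\delta$ for some $z\in Z$. For an automorphism $\alpha$ of a unital $C^*$-algebra $A$ and a seminorm $L:A\to[0,\infty]$, Kerr's product entropy is $$\mathrm{Entp}_L(\alpha)=\sup_{\Omega}\ \sup_{\delta>0}\ \limsup_{n\to\infty}\frac1n\log D\bigl(\Omega\,\alpha(\Omega)\,\alpha^2(\Omega)\cdots\alpha^{n-1}(\Omega),\delta\bigr),$$ where $\Omega$ runs over the finite subsets of $\{a\in A: L(a)<\infty,\ \|a\|\le 1\}$ and the product of sets is the set of products. Then $\Gamma$ is non-abelian and virtually abelian, and for every integer $k\ge1$ $$\log 2\ \le\ \mathrm{Entp}_{L^k_\ell}(\psi)\ \le\ 3\log 3 .$$ In particular the automorphism $\psi$ of the non-abelian group $\Gamma$ has finite, non-zero Kerr product entropy. -/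

import Mathlib

open scoped ENNReal

noncomputable section

/-! ### Product entropy of automorphisms of a C*-algebra -/

/-- `D(Y, δ)`: the least dimension of a finite-dimensional subspace `Z` such that every point of
`Y` is at distance less than `δ` from some point of `Z` (it is `⊤` if there is none). -/
def approxDim {X : Type*} [NormedAddCommGroup X] [NormedSpace ℂ X] (Y : Set X) (δ : ℝ) : ℕ∞ :=
  ⨅ (Z : Submodule ℂ X) (_ : FiniteDimensional ℂ Z) (_ : ∀ y ∈ Y, ∃ z ∈ Z, ‖y - z‖ < δ),
    (Module.finrank ℂ Z : ℕ∞)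

/-- The set `Ω · α(Ω) · α²(Ω) ⋯ αⁿ⁻¹(Ω)` of all ordered products
`a₀ α(a₁) α²(a₂) ⋯ αⁿ⁻¹(aₙ₋₁)` with all `aᵢ ∈ Ω`. -/
def orbitProduct {A : Type*} [CStarAlgebra A] (α : A ≃⋆ₐ[ℂ] A) (Ω : Set A) (n : ℕ) : Set A :=
  {x | ∃ a : Fin n → A, (∀ i, a i ∈ Ω) ∧ x = (List.ofFn fun i : Fin n => α^[(i : ℕ)] (a i)).prod}

/-- `Entp(α, Ω, δ) = limsup_{n → ∞} (1/n) log D(Ω α(Ω) ⋯ αⁿ⁻¹(Ω), δ)`, with `log 0 = -∞`. -/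
def productEntropyAt {A : Type*} [CStarAlgebra A] (α : A ≃⋆ₐ[ℂ] A) (Ω : Set A) (δ : ℝ) : EReal :=
  Filter.limsup
    (fun n : ℕ => ENNReal.log ((approxDim (orbitProduct α Ω n) δ : ℕ∞) : ℝ≥0∞) / (n : EReal))
    Filter.atTop

/-- Kerr's product entropy `Entp_L(α)`: the supremum of `Entp(α, Ω, δ)` over all `δ > 0` and all
finite subsets `Ω` of the unit ball of `A` on which the seminorm `L` is finite. -/
def productEntropy {A : Type*} [CStarAlgebra A] (L : A → ℝ≥0∞) (α : A ≃⋆ₐ[ℂ] A) : EReal :=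
  ⨆ (Ω : Finset A) (_ : ∀ a ∈ Ω, L a < ⊤ ∧ ‖a‖ ≤ 1) (δ : ℝ) (_ : 0 < δ),
    productEntropyAt α (Ω : Set A) δ

/-! ### The reduced group C*-algebra -/

section ReducedGroupAlgebra

variable {G : Type*}

/-- The Hilbert space `ℓ²(G)`. -/
abbrev EllTwo (G : Type*) : Type _ := lp (fun _ : G => ℂ) 2

lemma memlp_comp_perm (e : Equiv.Perm G) (ξ : EllTwo G) :
    Memℓp (fun h => (ξ : G → ℂ) (e h)) (2 : ℝ≥0∞) := by
  have h := lp.memℓp ξ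
  rw [memℓp_gen_iff (by norm_num)] at h ⊢
  exact (e.summable_iff (f := fun i => ‖(ξ : G → ℂ) i‖ ^ (2 : ℝ≥0∞).toReal)).2 h

/-- The isometry of `ℓ²(G)` induced by a permutation `e` of `G`; it maps `δ_h` to `δ_{e h}`. -/
def permIsometry (e : Equiv.Perm G) : EllTwo G ≃ₗᵢ[ℂ] EllTwo G where
  toFun ξ := ⟨fun h => (ξ : G → ℂ) (e.symm h), memlp_comp_perm e.symm ξ⟩
  invFun ξ := ⟨fun h => (ξ : G → ℂ) (e h), memlp_comp_perm e ξ⟩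
  map_add' _ _ := rfl
  map_smul' _ _ := rfl
  left_inv ξ := by ext h; simp
  right_inv ξ := by ext h; simp
  norm_map' ξ := by
    rw [lp.norm_eq_tsum_rpow (by norm_num), lp.norm_eq_tsum_rpow (by norm_num)]
    congr 1
    exact e.symm.tsum_eq (fun i => ‖(ξ : G → ℂ) i‖ ^ (2 : ℝ≥0∞).toReal)

/-- The unitary representation of the permutations of `G` on `ℓ²(G)`. -/
def permUnitary : Equiv.Perm G →* unitary (EllTwo G →L[ℂ] EllTwo G) :=
  (Unitary.linearIsometryEquiv (𝕜 := ℂ) (H := EllTwo G)).symm.toMonoidHom.comp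
    { toFun := permIsometry, map_one' := rfl, map_mul' := fun _ _ => rfl }

lemma permUnitary_apply (e : Equiv.Perm G) (ξ : EllTwo G) (h : G) :
    (((permUnitary e : EllTwo G →L[ℂ] EllTwo G) ξ : EllTwo G) : G → ℂ) h
      = (ξ : G → ℂ) (e.symm h) := rfl

variable [Group G]

/-- The left regular representation `g ↦ λ_g`, `λ_g δ_h = δ_{g h}`, of `G` on `ℓ²(G)`. -/
def leftRegular : G →* unitary (EllTwo G →L[ℂ] EllTwo G) :=
  permUnitary.comp (MulAction.toPermHom G G)

/-- The left regular representation `λ(∑ c_g δ_g) = ∑ c_g λ_g` of the convolution algebra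
`C_c(G)` of finitely supported functions. -/
def leftRegularAlg : MonoidAlgebra ℂ G →ₐ[ℂ] (EllTwo G →L[ℂ] EllTwo G) :=
  MonoidAlgebra.lift ℂ _ G ((unitary (EllTwo G →L[ℂ] EllTwo G)).subtype.comp leftRegular)

lemma leftRegularAlg_single (g : G) (c : ℂ) :
    leftRegularAlg (MonoidAlgebra.single g c)
      = c • (leftRegular g : EllTwo G →L[ℂ] EllTwo G) := by
  simp [leftRegularAlg, MonoidAlgebra.lift_single]

variable (G) in
/-- The image `λ(C_c(G))`, a *-subalgebra of the bounded operators on `ℓ²(G)`. -/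
def groupStarAlgebra : StarSubalgebra ℂ (EllTwo G →L[ℂ] EllTwo G) where
  toSubalgebra := leftRegularAlg.range
  star_mem' := by
    rintro _ ⟨f, rfl⟩
    change star (leftRegularAlg f) ∈ leftRegularAlg.range
    induction f using MonoidAlgebra.induction_linear with
    | zero => simp
    | add f g hf hg => rw [map_add, star_add]; exact add_mem hf hg
    | single g c =>
      refine ⟨MonoidAlgebra.single g⁻¹ (star c), ?_⟩
      change leftRegularAlg _ = _
      rw [leftRegularAlg_single, leftRegularAlg_single, star_smul, map_inv]
      rfl

variable (G) in
/-- The reduced group C*-algebra `C*_r(G)`, the norm closure of `λ(C_c(G))`. -/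
def reducedCStar : StarSubalgebra ℂ (EllTwo G →L[ℂ] EllTwo G) :=
  (groupStarAlgebra G).topologicalClosure

instance : IsClosed (reducedCStar G : Set (EllTwo G →L[ℂ] EllTwo G)) :=
  (groupStarAlgebra G).isClosed_topologicalClosure

instance : CStarAlgebra (reducedCStar G) := inferInstance

/-! ### The automorphism of `C*_r(G)` induced by an automorphism of `G` -/

lemma conj_leftRegular (ψ : G ≃* G) (g : G) :
    Unitary.conjStarAlgAut ℂ (EllTwo G →L[ℂ] EllTwo G) (permUnitary ψ.toEquiv)
        (leftRegular g : EllTwo G →L[ℂ] EllTwo G)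
      = (leftRegular (ψ g) : EllTwo G →L[ℂ] EllTwo G) := by
  have h : permUnitary ψ.toEquiv * leftRegular g = leftRegular (ψ g) * permUnitary ψ.toEquiv := by
    rw [leftRegular, MonoidHom.comp_apply, MonoidHom.comp_apply, ← map_mul, ← map_mul]
    congr 1
    ext x
    simp
  have h2 : permUnitary ψ.toEquiv * leftRegular g * star (permUnitary ψ.toEquiv)
      = leftRegular (ψ g) := by
    rw [h, mul_assoc, Unitary.mul_star_self, mul_one]
  simpa using congrArg Subtype.val h2

lemma conj_mem (ψ : G ≃* G) {a : EllTwo G →L[ℂ] EllTwo G} (ha : a ∈ reducedCStar G) :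
    Unitary.conjStarAlgAut ℂ (EllTwo G →L[ℂ] EllTwo G) (permUnitary ψ.toEquiv) a
      ∈ reducedCStar G := by
  set Φ := Unitary.conjStarAlgAut ℂ (EllTwo G →L[ℂ] EllTwo G) (permUnitary ψ.toEquiv) with hΦ
  have hc : Continuous Φ := by
    have : (Φ : (EllTwo G →L[ℂ] EllTwo G) → _) = fun x =>
      (permUnitary ψ.toEquiv : EllTwo G →L[ℂ] EllTwo G) * x
        * star (permUnitary ψ.toEquiv : EllTwo G →L[ℂ] EllTwo G) := rfl
    rw [this]; fun_prop
  refine map_mem_closure (s := (groupStarAlgebra G : Set (EllTwo G →L[ℂ] EllTwo G))) hc ha ?_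
  rintro _ ⟨f, rfl⟩
  change Φ (leftRegularAlg f) ∈ leftRegularAlg.range
  induction f using MonoidAlgebra.induction_linear with
  | zero => simp
  | add f g hf hg => rw [map_add, map_add]; exact add_mem hf hg
  | single g c =>
    refine ⟨MonoidAlgebra.single (ψ g) c, ?_⟩
    change leftRegularAlg _ = _
    rw [leftRegularAlg_single, leftRegularAlg_single, map_smul, hΦ, conj_leftRegular]

lemma conj_symm_conj (ψ : G ≃* G) (a : EllTwo G →L[ℂ] EllTwo G) :
    Unitary.conjStarAlgAut ℂ (EllTwo G →L[ℂ] EllTwo G) (permUnitary ψ.symm.toEquiv)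
      (Unitary.conjStarAlgAut ℂ (EllTwo G →L[ℂ] EllTwo G) (permUnitary ψ.toEquiv) a) = a := by
  have h : permUnitary ψ.symm.toEquiv * permUnitary ψ.toEquiv = 1 := by
    rw [← map_mul, ← map_one permUnitary]
    congr 1
    ext x
    exact ψ.symm_apply_apply x
  rw [← StarAlgEquiv.mul_apply, ← map_mul, h, map_one, StarAlgEquiv.one_apply]

/-- The automorphism of `C*_r(G)` induced by an automorphism `ψ` of `G`: the one determined by
`∑ c_g δ_g ↦ ∑ c_g δ_{ψ g}` (see `inducedAut_single`). It is conjugation by the unitary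
`δ_g ↦ δ_{ψ g}` of `ℓ²(G)`. -/
def inducedAut (ψ : G ≃* G) : reducedCStar G ≃⋆ₐ[ℂ] reducedCStar G where
  toFun a := ⟨Unitary.conjStarAlgAut ℂ _ (permUnitary ψ.toEquiv) a, conj_mem ψ a.2⟩
  invFun a := ⟨Unitary.conjStarAlgAut ℂ _ (permUnitary ψ.symm.toEquiv) a, conj_mem ψ.symm a.2⟩
  left_inv a := Subtype.ext (conj_symm_conj ψ a)
  right_inv a := Subtype.ext (conj_symm_conj ψ.symm a)
  map_mul' _ _ := Subtype.ext (map_mul _ _ _)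
  map_add' _ _ := Subtype.ext (map_add _ _ _)
  map_star' _ := Subtype.ext (map_star _ _)
  map_smul' _ _ := Subtype.ext (map_smul _ _ _)

lemma inducedAut_single (ψ : G ≃* G) (g : G) (a : reducedCStar G)
    (ha : (a : EllTwo G →L[ℂ] EllTwo G) = leftRegularAlg (MonoidAlgebra.single g 1)) :
    (inducedAut ψ a : EllTwo G →L[ℂ] EllTwo G)
      = leftRegularAlg (MonoidAlgebra.single (ψ g) 1) := by
  change Unitary.conjStarAlgAut ℂ _ (permUnitary ψ.toEquiv) (a : EllTwo G →L[ℂ] EllTwo G) = _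
  rw [ha, leftRegularAlg_single, leftRegularAlg_single, one_smul, one_smul, conj_leftRegular]

/-! ### The seminorms `L^k_ℓ` attached to a length function -/

/-- The word length of `g` with respect to `S`: the least `n` such that `g` is a product of `n`
elements of `S ∪ S⁻¹`. (Used only when `S` generates the group.) -/
def wordLength (S : Set G) (g : G) : ℕ :=
  sInf {n | ∃ w : List G, w.length = n ∧ (∀ s ∈ w, s ∈ S ∨ s⁻¹ ∈ S) ∧ w.prod = g}

/-- The inclusion of `C_c(G)` in `ℓ²(G)`. -/
def toEllTwo : MonoidAlgebra ℂ G →ₗ[ℂ] EllTwo G where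
  toFun ξ := ⟨fun g => ξ.coeff g, by
    refine memℓp_gen (summable_of_ne_finset_zero (s := ξ.coeff.support) fun g hg => ?_)
    rw [Finsupp.notMem_support_iff.1 hg]
    simp⟩
  map_add' _ _ := rfl
  map_smul' _ _ := rfl

/-- On `C_c(G)` the operator `λ(f)` is left convolution by `f`. -/
lemma leftRegularAlg_toEllTwo (f ξ : MonoidAlgebra ℂ G) :
    leftRegularAlg f (toEllTwo ξ) = toEllTwo (f * ξ) := by
  induction f using MonoidAlgebra.induction_linear with
  | zero => simp
  | add f g hf hg => rw [map_add, add_mul, map_add, ← hf, ← hg]; rfl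
  | single g c =>
    rw [leftRegularAlg_single]
    ext h
    change c * ξ.coeff (g⁻¹ * h) = (MonoidAlgebra.single g c * ξ).coeff h
    rw [MonoidAlgebra.coeff_single_mul_apply]

/-- The representation `λ` is injective on `C_c(G)`, so that `C_c(G)` is a subset of `C*_r(G)`. -/
lemma leftRegularAlg_injective :
    Function.Injective (leftRegularAlg : MonoidAlgebra ℂ G → EllTwo G →L[ℂ] EllTwo G) := by
  intro f f' h
  have h1 := leftRegularAlg_toEllTwo f 1
  rw [h, leftRegularAlg_toEllTwo, mul_one, mul_one] at h1
  ext g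
  exact (congrFun (congrArg Subtype.val h1) g).symm

/-- The operator `M_ℓ` with domain `C_c(G)`: `M_ℓ (∑ c_g δ_g) = ∑ ℓ(g) c_g δ_g`. -/
def lengthOp (ℓ : G → ℕ) : Module.End ℂ (MonoidAlgebra ℂ G) where
  toFun ξ := .ofCoeff (Finsupp.onFinset ξ.coeff.support (fun g => (ℓ g : ℂ) * ξ.coeff g)
    fun _ hg => Finsupp.mem_support_iff.2 (right_ne_zero_of_mul hg))
  map_add' ξ η := by ext g; simp [mul_add]
  map_smul' c ξ := by ext g; simp [mul_left_comm]

/-- The iterated commutator `Δ^k_ℓ(f) = [M_ℓ, [M_ℓ, … [M_ℓ, λ(f)] … ]]` (`k` brackets), as an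
operator on the invariant dense subspace `C_c(G)` of `ℓ²(G)`. -/
def iteratedCommutator (ℓ : G → ℕ) (k : ℕ) (f : MonoidAlgebra ℂ G) :
    Module.End ℂ (MonoidAlgebra ℂ G) :=
  (fun T => lengthOp ℓ * T - T * lengthOp ℓ)^[k] (LinearMap.mulLeft ℂ f)

/-- The operator norm, for the norm of `ℓ²(G)`, of an operator with the dense domain `C_c(G)`
(it is `⊤` exactly when the operator has no bounded extension). -/
def opNormOnFiniteSupport (T : Module.End ℂ (MonoidAlgebra ℂ G)) : ℝ≥0∞ :=
  ⨆ (ξ : MonoidAlgebra ℂ G) (_ : ‖toEllTwo ξ‖ ≤ 1), ‖toEllTwo (T ξ)‖ₑ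

/-- The seminorm `L^k_ℓ` on `C*_r(G)`: the operator norm of `Δ^k_ℓ(f)` at (the image of) an element
`f` of `C_c(G)`, and `+∞` outside `C_c(G)`. The infimum is over the unique `f` with `λ(f) = a`
or over the empty set. -/
def lipSeminorm (ℓ : G → ℕ) (k : ℕ) (a : reducedCStar G) : ℝ≥0∞ :=
  ⨅ (f : MonoidAlgebra ℂ G) (_ : leftRegularAlg f = (a : EllTwo G →L[ℂ] EllTwo G)),
    opNormOnFiniteSupport (iteratedCommutator ℓ k f)

end ReducedGroupAlgebra

/-! ### The groups `ℤᵈ ⋊_φ ℤ` and Arnold's cat map -/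

/-- The automorphism `x ↦ A x` of `ℤᵈ` (written multiplicatively) given by `A ∈ GL_d(ℤ)`. -/
def matrixAut (d : ℕ) : GL (Fin d) ℤ →* MulAut (Multiplicative (Fin d → ℤ)) where
  toFun A := AddEquiv.toMultiplicative
    (Matrix.GeneralLinearGroup.toLin A).toLinearEquiv.toAddEquiv
  map_one' := by ext x; simp
  map_mul' A B := by ext x; simp

/-- The group `ℤᵈ ⋊_φ ℤ` for `φ ∈ GL_d(ℤ)`: the generator `t` of `ℤ` acts by `t x t⁻¹ = φ x`. -/
abbrev MatrixSemidirect {d : ℕ} (φ : GL (Fin d) ℤ) : Type :=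
  Multiplicative (Fin d → ℤ) ⋊[zpowersHom _ (matrixAut d φ)] Multiplicative ℤ

/-- The automorphism `x ↦ ψ x` (`x ∈ ℤᵈ`), `t ↦ t` of `ℤᵈ ⋊_φ ℤ` given by `ψ ∈ GL_d(ℤ)`
commuting with `φ`. -/
def semidirectAut {d : ℕ} (φ ψ : GL (Fin d) ℤ) (h : Commute ψ φ) :
    MatrixSemidirect φ ≃* MatrixSemidirect φ :=
  SemidirectProduct.congr (matrixAut d ψ) (MulEquiv.refl _) (by
    intro n
    have h' : Commute (matrixAut d ψ) (zpowersHom _ (matrixAut d φ) n) := by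
      rw [zpowersHom_apply]
      exact (h.map (matrixAut d)).zpow_right _
    exact h')

/-- The group `ℤ² ⋊_{-I} ℤ`. -/
abbrev FlipGroup : Type := MatrixSemidirect (-1 : GL (Fin 2) ℤ)

/-- Arnold's cat map. -/
def catMatrix : GL (Fin 2) ℤ where
  val := !![2, 1; 1, 1]
  inv := !![1, -1; -1, 2]
  val_inv := by decide
  inv_val := by decide

/-- The automorphism of `ℤ² ⋊_{-I} ℤ` given by Arnold's cat map. -/
def catAut : FlipGroup ≃* FlipGroup :=
  semidirectAut (-1) catMatrix (Commute.neg_one_right _)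

end

/-!
The entropy measures, up to an error `δ`, the growth of the linear span of the products
`a₀ α(a₁) ⋯ αⁿ⁻¹(aₙ₋₁)`.

*Upper bound.* A finite set of elements of finite seminorm lies in the span of finitely many group
elements, say of those in a box `|x₀|, |x₁|, |m| ≤ R` of elements `(x, tᵐ)`. The group
multiplication adds the sides of boxes, since `t` acts on `ℤ²` by a sign, and the cat map enlarges
the sides in `ℤ²` by at most the factor `3`. By Horner's scheme
`a₀ α(a₁) ⋯ αⁿ(aₙ) = a₀ α(a₁ α(a₂) ⋯ αⁿ⁻¹(aₙ))` the `n`-fold products lie in the span of a box with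
sides `R 3ⁿ` in `ℤ²` and `R n` in `ℤ` (`exists_orbitProduct_subset_groupSpan`), which has at most
`(2R + 1)³ 27ⁿ` elements.

*Lower bound.* Commutators of `λ_g` with a subadditive length function are bounded
(`lipSeminorm_groupElement_lt_top`), so `Ω = {1, λ_{e₁}}` is admissible. Its `n`-fold products
contain `λ_x` for all `x = ∑ εᵢ Aⁱ e₁` with `εᵢ ∈ {0, 1}`, where `A` is the matrix of the cat map.
These `2ⁿ` vectors are distinct because the expanding eigenvalue `φ²` of `A` is at least `2`
(`one_le_abs_eigenFunctional_sub`). Distinct group elements map `δ_1` to orthonormal vectors, and a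
subspace that comes within `1/2` of `N` orthonormal vectors has dimension at least `3N/4`
(`card_mul_le_finrank_of_orthonormal`).
-/

/-! ### Exponential growth rates -/

lemma tendsto_log_const_mul_pow_div {c b : ℝ} (hc : 0 < c) (hb : 0 < b) :
    Filter.Tendsto
      (fun n : ℕ => ENNReal.log (ENNReal.ofReal (c * b ^ n)) / (n : EReal))
      Filter.atTop (nhds ((Real.log b : ℝ) : EReal)) := by
  have h1 : Filter.Tendsto (fun n : ℕ => Real.log c / (n : ℝ) + Real.log b) Filter.atTop
      (nhds (0 + Real.log b)) :=
    (tendsto_const_div_atTop_nhds_zero_nat _).add tendsto_const_nhds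
  rw [zero_add] at h1
  refine ((continuous_coe_real_ereal.tendsto _).comp h1).congr' ?_
  filter_upwards [Filter.eventually_gt_atTop 0] with n hn
  have hn' : (n : ℝ) ≠ 0 := by positivity
  rw [ENNReal.log_ofReal_of_pos (by positivity), Real.log_mul hc.ne' (by positivity),
    Real.log_pow, ← EReal.coe_coe_eq_natCast, ← EReal.coe_div]
  simp only [Function.comp_apply, EReal.coe_eq_coe_iff]
  field_simp

lemma log_le_limsup_log_div {f : ℕ → ℝ≥0∞} {c b : ℝ} (hc : 0 < c) (hb : 0 < b)
    (h : ∀ n, ENNReal.ofReal (c * b ^ n) ≤ f n) :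
    ((Real.log b : ℝ) : EReal)
      ≤ Filter.limsup (fun n : ℕ => ENNReal.log (f n) / (n : EReal)) Filter.atTop := by
  rw [← (tendsto_log_const_mul_pow_div hc hb).limsup_eq]
  exact Filter.limsup_le_limsup (Filter.Eventually.of_forall fun n =>
    EReal.div_le_div_right_of_nonneg (by positivity) (ENNReal.log_le_log (h n)))

lemma limsup_log_div_le_log {f : ℕ → ℝ≥0∞} {c b : ℝ} (hc : 0 < c) (hb : 0 < b)
    (h : ∀ n, f n ≤ ENNReal.ofReal (c * b ^ n)) :
    Filter.limsup (fun n : ℕ => ENNReal.log (f n) / (n : EReal)) Filter.atTop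
      ≤ ((Real.log b : ℝ) : EReal) := by
  rw [← (tendsto_log_const_mul_pow_div hc hb).limsup_eq]
  exact Filter.limsup_le_limsup (Filter.Eventually.of_forall fun n =>
    EReal.div_le_div_right_of_nonneg (by positivity) (ENNReal.log_le_log (h n)))

/-! ### Approximation dimension -/

/-- A subspace that contains every vector of a finite orthonormal family up to an error `δ` has
dimension at least `1 - δ²` times the number of vectors: the projections of the vectors have
squared length at least `1 - δ²`, and by Bessel's inequality these squared lengths add up to at
most the dimension. -/
lemma card_mul_le_finrank_of_orthonormal {H ι : Type*} [NormedAddCommGroup H]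
    [InnerProductSpace ℂ H] [Fintype ι] {v : ι → H} (hv : Orthonormal ℂ v)
    (Z : Submodule ℂ H) [FiniteDimensional ℂ Z] {δ : ℝ}
    (hZ : ∀ i, ∃ z ∈ Z, ‖v i - z‖ ≤ δ) :
    (Fintype.card ι : ℝ) * (1 - δ ^ 2) ≤ Module.finrank ℂ Z := by
  let b := stdOrthonormalBasis ℂ Z
  have hproj (i : ι) : 1 - δ ^ 2 ≤ ∑ j, ‖inner ℂ (v i) (b j : H)‖ ^ 2 := by
    obtain ⟨z, hz, hzδ⟩ := hZ i
    have h1 := Submodule.norm_sq_eq_add_norm_sq_projection (v i) Z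
    have h2 : ‖v i - Z.starProjection (v i)‖ ≤ δ := by
      rw [Submodule.starProjection_minimal]
      exact (ciInf_le ⟨0, by rintro _ ⟨w, rfl⟩; positivity⟩ (⟨z, hz⟩ : Z)).trans hzδ
    have h3 : ∑ j, ‖inner ℂ (v i) (b j : H)‖ ^ 2 = ‖Z.orthogonalProjectionOnto (v i)‖ ^ 2 := by
      rw [← b.sum_sq_norm_inner_left]
      refine Finset.sum_congr rfl fun j _ => ?_
      rw [← Submodule.inner_orthogonalProjectionOnto_eq_of_mem_right]
    have h4 : ‖Zᗮ.orthogonalProjectionOnto (v i)‖ = ‖v i - Z.starProjection (v i)‖ := by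
      rw [← Submodule.starProjection_orthogonal_val]
      rfl
    rw [hv.1 i, h4] at h1
    have h5 := pow_le_pow_left₀ (norm_nonneg _) h2 2
    rw [h3]
    linarith
  calc (Fintype.card ι : ℝ) * (1 - δ ^ 2)
    _ = ∑ _i : ι, (1 - δ ^ 2) := by
        rw [Finset.sum_const, Finset.card_univ, nsmul_eq_mul]
    _ ≤ ∑ i, ∑ j, ‖inner ℂ (v i) (b j : H)‖ ^ 2 := Finset.sum_le_sum fun i _ => hproj i
    _ = ∑ j, ∑ i, ‖inner ℂ (v i) (b j : H)‖ ^ 2 := Finset.sum_comm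
    _ ≤ ∑ j, ‖(b j : H)‖ ^ 2 := Finset.sum_le_sum fun j _ => hv.sum_inner_products_le _
    _ = Module.finrank ℂ Z := by
        have h1 (j) : ‖(b j : H)‖ = 1 := b.norm_eq_one j
        simp [h1]

lemma approxDim_le_finrank {X : Type*} [NormedAddCommGroup X] [NormedSpace ℂ X] {Y : Set X}
    {δ : ℝ} (hδ : 0 < δ) (Z : Submodule ℂ X) [h : FiniteDimensional ℂ Z] (hY : Y ⊆ Z) :
    approxDim Y δ ≤ Module.finrank ℂ Z :=
  iInf_le_of_le Z <| iInf_le_of_le h <| iInf_le_of_le (fun y hy => ⟨y, hY hy, by simpa⟩) le_rfl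

/-! ### Iterated products -/

lemma orbitProduct_zero {A : Type*} [CStarAlgebra A] (α : A ≃⋆ₐ[ℂ] A) (Ω : Set A) :
    orbitProduct α Ω 0 = {1} := by
  ext x
  simp [orbitProduct]

/-- Horner's scheme for the products `a₀ α(a₁) ⋯ αⁿ(aₙ) = a₀ α(a₁ α(a₂) ⋯ αⁿ⁻¹(aₙ))`. -/
lemma mem_orbitProduct_succ {A : Type*} [CStarAlgebra A] (α : A ≃⋆ₐ[ℂ] A) (Ω : Set A) (n : ℕ)
    (x : A) : x ∈ orbitProduct α Ω (n + 1) ↔ ∃ a ∈ Ω, ∃ y ∈ orbitProduct α Ω n, x = a * α y := by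
  have key (a : Fin (n + 1) → A) :
      (List.ofFn fun i : Fin (n + 1) => α^[(i : ℕ)] (a i)).prod
        = a 0 * α (List.ofFn fun i : Fin n => α^[(i : ℕ)] (a i.succ)).prod := by
    simp [List.ofFn_succ, map_list_prod, List.map_ofFn, Function.comp_def,
      Function.iterate_succ_apply']
  constructor
  · rintro ⟨a, ha, rfl⟩
    exact ⟨a 0, ha 0, _, ⟨fun i => a i.succ, fun i => ha _, rfl⟩, key a⟩
  · rintro ⟨a, ha, _, ⟨b, hb, rfl⟩, rfl⟩
    refine ⟨Fin.cons a b, fun i => ?_, ?_⟩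
    · cases i using Fin.cases <;> simp [ha, hb]
    · rw [key]; simp

/-! ### Group elements in the reduced group C*-algebra -/

section GroupElements

lemma orthonormal_toEllTwo_single {G : Type*} :
    Orthonormal ℂ fun g : G => toEllTwo (MonoidAlgebra.single g 1) := by
  classical
  have h (g : G) : toEllTwo (MonoidAlgebra.single g (1 : ℂ)) = lp.single 2 g 1 := by
    ext h
    change (MonoidAlgebra.single g (1 : ℂ)).coeff h = _
    simp [Finsupp.single_apply, Pi.single_apply, eq_comm]
  rw [orthonormal_iff_ite]
  intro g g'
  rw [h, h, lp.inner_single_left]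
  simp [Pi.single_apply]

variable {G : Type*} [Group G]

lemma leftRegularAlg_mem_reducedCStar (f : MonoidAlgebra ℂ G) :
    leftRegularAlg f ∈ reducedCStar G :=
  (groupStarAlgebra G).le_topologicalClosure ⟨f, rfl⟩

/-- The homomorphism `g ↦ λ_g` into the reduced group C*-algebra. -/
noncomputable def groupElement : G →* reducedCStar G where
  toFun g := ⟨leftRegularAlg (MonoidAlgebra.single g 1), leftRegularAlg_mem_reducedCStar _⟩
  map_one' := Subtype.ext (map_one leftRegularAlg)
  map_mul' g h := Subtype.ext <| by
    change leftRegularAlg _ = leftRegularAlg _ * leftRegularAlg _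
    rw [← map_mul, MonoidAlgebra.single_mul_single, one_mul]

lemma coe_groupElement (g : G) : (groupElement g : EllTwo G →L[ℂ] EllTwo G)
    = leftRegularAlg (MonoidAlgebra.single g 1) := rfl

lemma norm_groupElement_le (g : G) : ‖groupElement g‖ ≤ 1 := by
  change ‖(groupElement g : EllTwo G →L[ℂ] EllTwo G)‖ ≤ 1
  rw [coe_groupElement, leftRegularAlg_single, one_smul]
  refine ContinuousLinearMap.opNorm_le_bound _ zero_le_one fun ξ => ?_
  rw [one_mul]
  exact ((permIsometry (MulAction.toPermHom G G g)).norm_map ξ).le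

lemma inducedAut_groupElement (ψ : G ≃* G) (g : G) :
    inducedAut ψ (groupElement g) = groupElement (ψ g) :=
  Subtype.ext (inducedAut_single ψ g _ rfl)

lemma groupElement_apply_one (g : G) :
    (groupElement g : EllTwo G →L[ℂ] EllTwo G) (toEllTwo 1)
      = toEllTwo (MonoidAlgebra.single g 1) := by
  rw [coe_groupElement, leftRegularAlg_toEllTwo, mul_one]

/-- If `Y` contains `N` group elements then `N ≤ 2 D(Y, 1/2)`: evaluation at `δ_1` is a
contraction that maps distinct group elements to orthonormal vectors. -/
lemma natCeil_half_card_le_approxDim (E : Finset G) {Y : Set (reducedCStar G)}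
    (hY : ∀ g ∈ E, groupElement g ∈ Y) :
    ((⌈(1 / 2 : ℝ) * E.card⌉₊ : ℕ) : ℕ∞) ≤ approxDim Y (1 / 2) := by
  refine le_iInf fun Z => le_iInf fun hfin => le_iInf fun hZ => ?_
  have hone : ‖toEllTwo (1 : MonoidAlgebra ℂ G)‖ = 1 := orthonormal_toEllTwo_single.1 1
  let ev : reducedCStar G →ₗ[ℂ] EllTwo G :=
    { toFun := fun a => (a : EllTwo G →L[ℂ] EllTwo G) (toEllTwo 1)
      map_add' := fun _ _ => rfl
      map_smul' := fun _ _ => rfl }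
  have hv : Orthonormal ℂ fun g : E => toEllTwo (MonoidAlgebra.single (g : G) 1) :=
    orthonormal_toEllTwo_single.comp _ Subtype.val_injective
  have h := card_mul_le_finrank_of_orthonormal hv (Z.map ev) (δ := 1 / 2) fun g => by
    obtain ⟨z, hz, hgz⟩ := hZ _ (hY g g.2)
    refine ⟨ev z, Submodule.mem_map_of_mem hz, ?_⟩
    rw [← groupElement_apply_one]
    change ‖((groupElement (g : G) - z : reducedCStar G) : EllTwo G →L[ℂ] EllTwo G)
      (toEllTwo 1)‖ ≤ _
    refine (ContinuousLinearMap.le_opNorm _ _).trans ?_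
    rw [hone, mul_one]
    exact hgz.le
  have h2 : (Module.finrank ℂ (Z.map ev) : ℝ) ≤ Module.finrank ℂ Z := by
    exact_mod_cast Submodule.finrank_map_le ev Z
  rw [Fintype.card_coe] at h
  rw [Nat.cast_le, Nat.ceil_le]
  have : (0 : ℝ) ≤ E.card := by positivity
  linarith

/-- The span of the group elements in `B`, that is the image of the functions supported in `B`. -/
noncomputable def groupSpan (B : Set G) : Submodule ℂ (reducedCStar G) :=
  Submodule.span ℂ (groupElement '' B)

lemma groupElement_mem_groupSpan {B : Set G} {g : G} (hg : g ∈ B) : groupElement g ∈ groupSpan B :=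
  Submodule.subset_span ⟨g, hg, rfl⟩

lemma groupSpan_mono {B B' : Set G} (h : B ⊆ B') : groupSpan B ≤ groupSpan B' :=
  Submodule.span_mono (Set.image_mono h)

open scoped Pointwise in
lemma mul_mem_groupSpan {B B' : Set G} {a b : reducedCStar G} (ha : a ∈ groupSpan B)
    (hb : b ∈ groupSpan B') : a * b ∈ groupSpan (B * B') := by
  have h := Submodule.mul_mem_mul ha hb
  rwa [groupSpan, groupSpan, Submodule.span_mul_span, ← Set.image_mul] at h

lemma inducedAut_mem_groupSpan (ψ : G ≃* G) {B : Set G} {a : reducedCStar G}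
    (ha : a ∈ groupSpan B) : inducedAut ψ a ∈ groupSpan (ψ '' B) := by
  induction ha using Submodule.span_induction with
  | mem x hx =>
    obtain ⟨g, hg, rfl⟩ := hx
    rw [inducedAut_groupElement]
    exact groupElement_mem_groupSpan ⟨g, hg, rfl⟩
  | zero => rw [map_zero]; exact zero_mem _
  | add x y _ _ hx hy => rw [map_add]; exact add_mem hx hy
  | smul c x _ hx => rw [map_smul]; exact Submodule.smul_mem _ c hx

instance (B : Finset G) : FiniteDimensional ℂ (groupSpan (B : Set G)) :=
  FiniteDimensional.span_of_finite ℂ (B.finite_toSet.image _)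

lemma finrank_groupSpan_le (B : Finset G) :
    Module.finrank ℂ (groupSpan (B : Set G)) ≤ B.card := by
  classical
  rw [groupSpan, ← Finset.coe_image]
  exact (finrank_span_finset_le_card _).trans Finset.card_image_le

lemma exists_mem_groupSpan_of_lipSeminorm_lt_top {ℓ : G → ℕ} {k : ℕ} {a : reducedCStar G}
    (ha : lipSeminorm ℓ k a < ⊤) : ∃ F : Finset G, a ∈ groupSpan (F : Set G) := by
  obtain ⟨f, hf⟩ := iInf_lt_top.1 ha
  obtain ⟨hfa, -⟩ := iInf_lt_top.1 hf
  refine ⟨f.coeff.support, ?_⟩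
  have h : a = ∑ g ∈ f.coeff.support, f.coeff g • groupElement g := by
    apply Subtype.ext
    rw [← hfa, leftRegularAlg, MonoidAlgebra.lift_apply, AddSubmonoidClass.coe_finsetSum]
    refine Finset.sum_congr rfl fun g _ => ?_
    change _ = f.coeff g • (groupElement g : EllTwo G →L[ℂ] EllTwo G)
    rw [coe_groupElement, leftRegularAlg_single, one_smul]
    rfl
  rw [h]
  exact Submodule.sum_mem _ fun g hg =>
    Submodule.smul_mem _ _ (groupElement_mem_groupSpan hg)

/-! ### Group elements have finite seminorm -/

lemma wordLength_mul_le {S : Set G} (hS : Subgroup.closure S = ⊤) (g h : G) :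
    wordLength S (g * h) ≤ wordLength S g + wordLength S h := by
  have hw (x : G) : ∃ w : List G, w.length = wordLength S x ∧ (∀ s ∈ w, s ∈ S ∨ s⁻¹ ∈ S) ∧
      w.prod = x := by
    have hx : x ∈ Submonoid.closure (S ∪ S⁻¹) := by
      rw [← Subgroup.closure_toSubmonoid, hS]
      trivial
    obtain ⟨w, hw, hp⟩ := Submonoid.exists_list_of_mem_closure hx
    exact Nat.sInf_mem (s := {n | ∃ w : List G, w.length = n ∧ (∀ s ∈ w, s ∈ S ∨ s⁻¹ ∈ S) ∧
      w.prod = x}) ⟨_, w, rfl, hw, hp⟩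
  obtain ⟨v, hv, hvS, hvg⟩ := hw g
  obtain ⟨w, hw, hwS, hwh⟩ := hw h
  refine Nat.sInf_le ⟨v ++ w, by simp [hv, hw], fun s hs => ?_, by simp [hvg, hwh]⟩
  exact (List.mem_append.1 hs).elim (hvS s) (hwS s)

lemma iteratedCommutator_single_coeff (ℓ : G → ℕ) (k : ℕ) (g : G) (ξ : MonoidAlgebra ℂ G) (h : G) :
    (iteratedCommutator ℓ k (MonoidAlgebra.single g 1) ξ).coeff h
      = ((ℓ h : ℂ) - ℓ (g⁻¹ * h)) ^ k * ξ.coeff (g⁻¹ * h) := by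
  induction k generalizing ξ with
  | zero =>
    change (MonoidAlgebra.single g 1 * ξ).coeff h = _
    simp [MonoidAlgebra.coeff_single_mul_apply]
  | succ k ih =>
    have hM (η : MonoidAlgebra ℂ G) (x : G) : (lengthOp ℓ η).coeff x = ℓ x * η.coeff x := rfl
    have hT : iteratedCommutator ℓ (k + 1) (MonoidAlgebra.single g 1) ξ
        = lengthOp ℓ (iteratedCommutator ℓ k (MonoidAlgebra.single g 1) ξ)
          - iteratedCommutator ℓ k (MonoidAlgebra.single g 1) (lengthOp ℓ ξ) := by
      rw [iteratedCommutator, Function.iterate_succ_apply']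
      rfl
    rw [hT, MonoidAlgebra.coeff_sub, Finsupp.sub_apply, hM, ih, ih, hM]
    ring

/-- For a subadditive length function the `k`-th commutator with `λ_g` is bounded: it multiplies
`δ_h ↦ δ_{gh}` by `(ℓ(gh) - ℓ(h))ᵏ`, and `|ℓ(gh) - ℓ(h)| ≤ max (ℓ g) (ℓ g⁻¹)`. -/
lemma lipSeminorm_groupElement_lt_top {ℓ : G → ℕ} (hℓ : ∀ g h, ℓ (g * h) ≤ ℓ g + ℓ h) (k : ℕ)
    (g : G) : lipSeminorm ℓ k (groupElement g) < ⊤ := by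
  set C : ℕ := max (ℓ g) (ℓ g⁻¹)
  have hinf : lipSeminorm ℓ k (groupElement g)
      ≤ opNormOnFiniteSupport (iteratedCommutator ℓ k (MonoidAlgebra.single g 1)) :=
    iInf₂_le (f := fun f (_ : leftRegularAlg f = (groupElement g : EllTwo G →L[ℂ] EllTwo G)) =>
      opNormOnFiniteSupport (iteratedCommutator ℓ k f)) (MonoidAlgebra.single g 1) rfl
  refine (hinf.trans (iSup₂_le fun ξ hξ => ?_)).trans_lt
    (ENNReal.coe_lt_top (r := (C : NNReal) ^ k))
  have hC (h : G) : ‖(ℓ h : ℂ) - ℓ (g⁻¹ * h)‖ ≤ C := by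
    have h1 := hℓ g (g⁻¹ * h)
    have h2 := hℓ g⁻¹ h
    rw [mul_inv_cancel_left] at h1
    have h3 : |((ℓ h : ℤ) - ℓ (g⁻¹ * h))| ≤ C := by rw [abs_le]; omega
    rw [← Int.cast_natCast (ℓ h), ← Int.cast_natCast (ℓ (g⁻¹ * h)), ← Int.cast_sub,
      Complex.norm_intCast]
    exact_mod_cast h3
  have hle : ‖toEllTwo (iteratedCommutator ℓ k (MonoidAlgebra.single g 1) ξ)‖
      ≤ ‖((C : ℂ) ^ k) • leftRegularAlg (MonoidAlgebra.single g 1) (toEllTwo ξ)‖ := by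
    rw [leftRegularAlg_toEllTwo]
    refine lp.norm_mono (by norm_num) fun h => ?_
    change ‖(iteratedCommutator ℓ k (MonoidAlgebra.single g 1) ξ).coeff h‖
      ≤ ‖(C : ℂ) ^ k * (MonoidAlgebra.single g 1 * ξ).coeff h‖
    rw [iteratedCommutator_single_coeff, MonoidAlgebra.coeff_single_mul_apply, one_mul,
      norm_mul, norm_mul, norm_pow, norm_pow, Complex.norm_natCast]
    gcongr
    exact hC h
  have h1 : ‖leftRegularAlg (MonoidAlgebra.single g 1) (toEllTwo ξ)‖ ≤ 1 :=
    (ContinuousLinearMap.le_of_opNorm_le _ (norm_groupElement_le g) _).trans (by simpa using hξ)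
  have h2 : ‖toEllTwo (iteratedCommutator ℓ k (MonoidAlgebra.single g 1) ξ)‖ ≤ (C : ℝ) ^ k := by
    refine hle.trans ?_
    rw [norm_smul, norm_pow, Complex.norm_natCast]
    exact mul_le_of_le_one_right (by positivity) h1
  rw [← ofReal_norm]
  refine (ENNReal.ofReal_le_ofReal h2).trans_eq ?_
  rw [← ENNReal.ofReal_coe_nnreal]
  simp

end GroupElements

/-! ### The group `ℤ² ⋊ ℤ` -/

namespace FlipGroup

open scoped Pointwise goldenRatio

/-- The element `x` of the normal subgroup `ℤ²`. -/
def translation (x : Fin 2 → ℤ) : FlipGroup := SemidirectProduct.inl (Multiplicative.ofAdd x)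

lemma translation_injective : Function.Injective translation :=
  SemidirectProduct.inl_injective.comp Multiplicative.ofAdd.injective

lemma translation_add (x y : Fin 2 → ℤ) :
    translation (x + y) = translation x * translation y :=
  map_mul SemidirectProduct.inl _ _

lemma translation_zero : translation 0 = 1 := map_one SemidirectProduct.inl

lemma catAut_translation (x : Fin 2 → ℤ) :
    catAut (translation x) = translation (!![2, 1; 1, 1].mulVec x) := by
  apply SemidirectProduct.ext <;> rfl

/-- The action of `n ∈ ℤ` on `ℤ²` is `x ↦ (-1)ⁿ x`. -/
lemma action_apply (n : Multiplicative ℤ) (x : Multiplicative (Fin 2 → ℤ)) (i : Fin 2) :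
    (zpowersHom _ (matrixAut 2 (-1)) n x).toAdd i = (-1) ^ n.toAdd.natAbs * x.toAdd i := by
  have h1 : (matrixAut 2 (-1) x).toAdd = -x.toAdd := by
    change Matrix.mulVec (-1 : Matrix (Fin 2) (Fin 2) ℤ) x.toAdd = _
    simp [Matrix.neg_mulVec]
  rw [zpowersHom_apply, ← map_zpow]
  rcases Int.even_or_odd n.toAdd with h | h
  · rw [h.neg_one_zpow, map_one, (Int.natAbs_even.2 h).neg_one_pow]
    simp
  · rw [h.neg_one_zpow, (Int.natAbs_odd.2 h).neg_one_pow, h1]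
    simp

lemma exists_not_commute : ∃ g h : FlipGroup, g * h ≠ h * g := by
  refine ⟨translation ![1, 0], SemidirectProduct.inr (Multiplicative.ofAdd 1), fun h => ?_⟩
  have h1 := congrFun (congrArg (fun g : FlipGroup => g.left.toAdd) h) 0
  simp only [translation, SemidirectProduct.mul_left, SemidirectProduct.left_inl,
    SemidirectProduct.left_inr, SemidirectProduct.right_inl, SemidirectProduct.right_inr,
    map_one, mul_one, one_mul, action_apply] at h1
  revert h1
  simp

/-- The subgroup `ℤ² × 2ℤ`, the kernel of the reduction mod `2` of the `ℤ`-component, is abelian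
and has index two. -/
lemma exists_finiteIndex_commute : ∃ H : Subgroup FlipGroup, H.FiniteIndex ∧
    ∀ g ∈ H, ∀ h ∈ H, g * h = h * g := by
  let p : FlipGroup →* Multiplicative (ZMod 2) :=
    (AddMonoidHom.toMultiplicative (Int.castAddHom (ZMod 2))).comp SemidirectProduct.rightHom
  refine ⟨p.ker, Subgroup.finiteIndex_ker p, ?_⟩
  have heven (g : FlipGroup) (hg : g ∈ p.ker) : Even g.right.toAdd := by
    have : ((g.right.toAdd : ℤ) : ZMod 2) = 0 := hg
    rwa [ZMod.intCast_eq_zero_iff_even] at this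
  have hact (g : FlipGroup) (hg : g ∈ p.ker) (x : Multiplicative (Fin 2 → ℤ)) :
      zpowersHom _ (matrixAut 2 (-1)) g.right x = x := by
    apply Multiplicative.toAdd.injective
    funext i
    rw [action_apply, (Int.natAbs_even.2 (heven g hg)).neg_one_pow, one_mul]
  intro g hg h hh
  apply SemidirectProduct.ext
  · rw [SemidirectProduct.mul_left, SemidirectProduct.mul_left, hact g hg, hact h hh, mul_comm]
  · exact mul_comm _ _

/-! ### Growth of boxes -/

/-- The elements `(x, tᵐ)` with `|x₀|, |x₁| ≤ r` and `|m| ≤ c`. -/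
def box (r c : ℕ) : Set FlipGroup :=
  {g | (∀ i, |g.left.toAdd i| ≤ r) ∧ |g.right.toAdd| ≤ c}

lemma box_mono {r r' c c' : ℕ} (hr : r ≤ r') (hc : c ≤ c') : box r c ⊆ box r' c' := fun _ hg =>
  ⟨fun i => (hg.1 i).trans (by exact_mod_cast hr), hg.2.trans (by exact_mod_cast hc)⟩

lemma one_mem_box (r c : ℕ) : (1 : FlipGroup) ∈ box r c := ⟨fun _ => by simp, by simp⟩

lemma box_mul_box_subset (r r' c c' : ℕ) : box r c * box r' c' ⊆ box (r + r') (c + c') := by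
  rintro _ ⟨g, hg, h, hh, rfl⟩
  constructor
  · intro i
    have h1 : |(-1) ^ g.right.toAdd.natAbs * h.left.toAdd i| = |h.left.toAdd i| := by
      simp [abs_mul]
    change |(g.left * zpowersHom _ (matrixAut 2 (-1)) g.right h.left).toAdd i| ≤ _
    rw [toAdd_mul, Pi.add_apply, action_apply, Nat.cast_add]
    exact (abs_add_le _ _).trans (add_le_add (hg.1 i) (h1.trans_le (hh.1 i)))
  · change |g.right.toAdd + h.right.toAdd| ≤ _
    rw [Nat.cast_add]
    exact (abs_add_le _ _).trans (add_le_add hg.2 hh.2)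

/-- The cat map multiplies the sup norm on `ℤ²` by at most `3`. -/
lemma catAut_image_box_subset (r c : ℕ) : catAut '' box r c ⊆ box (3 * r) c := by
  rintro _ ⟨g, hg, rfl⟩
  refine ⟨fun i => ?_, hg.2⟩
  change |(!![2, 1; 1, 1] : Matrix (Fin 2) (Fin 2) ℤ).mulVec g.left.toAdd i| ≤ _
  have h0 := abs_le.1 (hg.1 0)
  have h1 := abs_le.1 (hg.1 1)
  rw [abs_le]
  fin_cases i <;> simp [Matrix.mulVec, dotProduct, Fin.sum_univ_two] <;> constructor <;> linarith

lemma exists_subset_box (F : Finset FlipGroup) : ∃ r : ℕ, (F : Set FlipGroup) ⊆ box r r := by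
  let N (g : FlipGroup) : ℕ :=
    (g.left.toAdd 0).natAbs + (g.left.toAdd 1).natAbs + g.right.toAdd.natAbs
  refine ⟨F.sup N, fun g hg => box_mono (Finset.le_sup (f := N) hg) (Finset.le_sup (f := N) hg) ?_⟩
  refine ⟨fun i => ?_, ?_⟩
  · have h0 := abs_nonneg (g.left.toAdd 0)
    have h1 := abs_nonneg (g.left.toAdd 1)
    have h2 := abs_nonneg g.right.toAdd
    fin_cases i <;> simp [N] <;> linarith
  · simp only [N]
    push_cast [Int.natCast_natAbs]
    exact le_add_of_nonneg_left (by positivity)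

lemma exists_finset_eq_box (r c : ℕ) :
    ∃ B : Finset FlipGroup, (B : Set FlipGroup) = box r c ∧
      B.card ≤ (2 * r + 1) ^ 2 * (2 * c + 1) := by
  classical
  let I (m : ℕ) : Finset ℤ := Finset.Icc (-m) m
  have hI (m : ℕ) : (I m).card = 2 * m + 1 := by simp [I]; omega
  let e (y : (ℤ × ℤ) × ℤ) : FlipGroup :=
    ⟨Multiplicative.ofAdd ![y.1.1, y.1.2], Multiplicative.ofAdd y.2⟩
  refine ⟨((I r ×ˢ I r) ×ˢ I c).image e, ?_, ?_⟩
  · ext g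
    simp only [Finset.coe_image, Set.mem_image, Finset.mem_coe, Finset.mem_product, I,
      Finset.mem_Icc, ← abs_le]
    constructor
    · rintro ⟨y, ⟨⟨h0, h1⟩, h2⟩, rfl⟩
      refine ⟨fun i => ?_, h2⟩
      fin_cases i
      · exact h0
      · exact h1
    · intro hg
      refine ⟨((g.left.toAdd 0, g.left.toAdd 1), g.right.toAdd), ⟨⟨hg.1 0, hg.1 1⟩, hg.2⟩, ?_⟩
      apply SemidirectProduct.ext
      · apply Multiplicative.toAdd.injective
        funext i
        fin_cases i <;> rfl
      · rfl
  · refine Finset.card_image_le.trans_eq ?_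
    simp [Finset.card_product, hI, sq]

/-! ### The upper bound -/

/-- By Horner's scheme the radii of the boxes satisfy `r ↦ R + 3 r` and `c ↦ R + c`; this
recursion preserves the bound `r + R ≤ R 3ⁿ`. -/
lemma exists_orbitProduct_subset_groupSpan {R : ℕ} {Ω : Set (reducedCStar FlipGroup)}
    (hΩ : Ω ⊆ groupSpan (box R R)) (n : ℕ) :
    ∃ r : ℕ, orbitProduct (inducedAut catAut) Ω n ⊆ groupSpan (box r (R * n)) ∧
      r + R ≤ R * 3 ^ n := by
  induction n with
  | zero =>
    refine ⟨0, ?_, by simp⟩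
    rw [orbitProduct_zero, Set.singleton_subset_iff, ← map_one (groupElement (G := FlipGroup))]
    exact groupElement_mem_groupSpan (one_mem_box _ _)
  | succ n ih =>
    obtain ⟨r, hsub, hr⟩ := ih
    refine ⟨R + 3 * r, fun x hx => ?_, by rw [pow_succ]; linarith⟩
    obtain ⟨a, ha, y, hy, rfl⟩ := (mem_orbitProduct_succ _ _ _ _).1 hx
    have h1 := mul_mem_groupSpan (hΩ ha) (inducedAut_mem_groupSpan catAut (hsub hy))
    refine groupSpan_mono (((Set.mul_subset_mul_left (catAut_image_box_subset _ _)).trans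
      (box_mul_box_subset _ _ _ _)).trans (box_mono le_rfl ?_)) h1
    rw [mul_add, mul_one, add_comm]

lemma approxDim_orbitProduct_le {R : ℕ} {Ω : Set (reducedCStar FlipGroup)}
    (hΩ : Ω ⊆ groupSpan (box R R)) {δ : ℝ} (hδ : 0 < δ) (n : ℕ) :
    approxDim (orbitProduct (inducedAut catAut) Ω n) δ
      ≤ (((2 * R + 1) ^ 3 * 27 ^ n : ℕ) : ℕ∞) := by
  obtain ⟨r, hsub, hr⟩ := exists_orbitProduct_subset_groupSpan hΩ n
  obtain ⟨B, hB, hcard⟩ := exists_finset_eq_box r (R * n)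
  rw [← hB] at hsub
  refine (approxDim_le_finrank hδ _ hsub).trans (Nat.cast_le.2 ?_)
  refine (finrank_groupSpan_le B).trans (hcard.trans ?_)
  replace hr : r ≤ R * 3 ^ n := (Nat.le_add_right _ _).trans hr
  have hn : n ≤ 3 ^ n := (Nat.lt_pow_self (by norm_num)).le
  have h1 : 1 ≤ 3 ^ n := Nat.one_le_pow _ _ (by norm_num)
  calc (2 * r + 1) ^ 2 * (2 * (R * n) + 1)
      ≤ (2 * (R * 3 ^ n) + 3 ^ n) ^ 2 * (2 * (R * 3 ^ n) + 3 ^ n) := by gcongr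
    _ = (2 * R + 1) ^ 3 * (3 ^ 3) ^ n := by rw [← pow_mul, mul_comm 3 n, pow_mul]; ring
    _ = _ := by norm_num

lemma productEntropy_le (ℓ : FlipGroup → ℕ) (k : ℕ) :
    productEntropy (lipSeminorm ℓ k) (inducedAut catAut) ≤ ((3 * Real.log 3 : ℝ) : EReal) := by
  refine iSup₂_le fun Ω hΩ => iSup₂_le fun δ hδ => ?_
  have hR (a : reducedCStar FlipGroup) (ha : a ∈ Ω) : ∃ r : ℕ, a ∈ groupSpan (box r r) := by
    obtain ⟨F, hF⟩ := exists_mem_groupSpan_of_lipSeminorm_lt_top (hΩ a ha).1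
    obtain ⟨r, hr⟩ := exists_subset_box F
    exact ⟨r, groupSpan_mono hr hF⟩
  choose! r hr using hR
  have hsub : (Ω : Set (reducedCStar FlipGroup)) ⊆ groupSpan (box (Ω.sup r) (Ω.sup r)) :=
    fun a ha => groupSpan_mono (box_mono (Finset.le_sup ha) (Finset.le_sup ha)) (hr a ha)
  have h27 : 3 * Real.log 3 = Real.log 27 := by
    rw [show (27 : ℝ) = 3 ^ 3 by norm_num, Real.log_pow]; norm_num
  rw [h27]
  refine limsup_log_div_le_log (c := ((2 * Ω.sup r + 1 : ℕ) : ℝ) ^ 3) (by positivity)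
    (by norm_num) fun n => ?_
  refine (ENat.toENNReal_le.2 (approxDim_orbitProduct_le hsub hδ n)).trans_eq ?_
  rw [ENat.toENNReal_coe, ← ENNReal.ofReal_natCast]
  congr 1
  push_cast
  rfl

/-! ### The lower bound -/

/-- The vector `∑ᵢ εᵢ Aⁱ e₁` for a word `ε` of zeros and ones, with `A` the matrix of the cat
map. -/
def catSum : List Bool → Fin 2 → ℤ
  | [] => 0
  | b :: w => (if b then ![1, 0] else 0)
      + (!![2, 1; 1, 1] : Matrix (Fin 2) (Fin 2) ℤ).mulVec (catSum w)

/-- The left eigenvector `(1, φ - 1)` of the cat map for the eigenvalue `φ²`, `φ` the golden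
ratio, as a linear functional. -/
noncomputable def eigenFunctional (x : Fin 2 → ℤ) : ℝ := x 0 + (φ - 1) * x 1

lemma eigenFunctional_catSum_cons (b : Bool) (w : List Bool) :
    eigenFunctional (catSum (b :: w))
      = (if b then 1 else 0) + (φ + 1) * eigenFunctional (catSum w) := by
  have h := Real.goldenRatio_sq
  cases b <;>
  · simp [catSum, eigenFunctional, dotProduct, Fin.sum_univ_two]
    linear_combination (-(catSum w 1 : ℝ)) * h

/-- Since the eigenvalue `φ² = φ + 1` is at least `2`, the values at distinct words of the same
length differ by at least `1`: if the tails differ, then by at least `2 - 1`. -/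
lemma one_le_abs_eigenFunctional_sub {v w : List Bool} (hlen : v.length = w.length)
    (hne : v ≠ w) : 1 ≤ |eigenFunctional (catSum v) - eigenFunctional (catSum w)| := by
  induction v generalizing w with
  | nil => exact absurd (List.length_eq_zero_iff.1 hlen.symm).symm hne
  | cons b v ih =>
    cases w with
    | nil => simp at hlen
    | cons c w =>
      rw [eigenFunctional_catSum_cons, eigenFunctional_catSum_cons]
      by_cases hvw : v = w
      · subst hvw
        have hbc : b ≠ c := fun h => hne (by rw [h])
        cases b <;> cases c <;> simp_all
      · have h1 := ih (by simpa using hlen) hvw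
        have hφ := Real.one_lt_goldenRatio
        rw [le_abs] at h1 ⊢
        rcases h1 with h1 | h1
        · left
          have := mul_le_mul (a := (2 : ℝ)) (b := φ + 1) (by linarith) h1 zero_le_one (by linarith)
          cases b <;> cases c <;> simp <;> linarith
        · right
          have := mul_le_mul (a := (2 : ℝ)) (b := φ + 1) (by linarith) h1 zero_le_one (by linarith)
          cases b <;> cases c <;> simp <;> linarith

lemma groupElement_catSum_mem {Ω : Set (reducedCStar FlipGroup)} (h1 : 1 ∈ Ω)
    (hx : groupElement (translation ![1, 0]) ∈ Ω) (w : List Bool) :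
    groupElement (translation (catSum w)) ∈ orbitProduct (inducedAut catAut) Ω w.length := by
  induction w with
  | nil =>
    rw [List.length_nil, orbitProduct_zero, catSum, translation_zero, map_one]
    rfl
  | cons b w ih =>
    rw [List.length_cons, mem_orbitProduct_succ]
    refine ⟨groupElement (translation (if b then ![1, 0] else 0)), ?_, _, ih, ?_⟩
    · cases b
      · rw [if_neg Bool.false_ne_true, translation_zero, map_one]
        exact h1
      · rwa [if_pos rfl]
    · rw [inducedAut_groupElement, catAut_translation, ← map_mul, ← translation_add, catSum]

lemma le_productEntropy {ℓ : FlipGroup → ℕ} (hℓ : ∀ g h, ℓ (g * h) ≤ ℓ g + ℓ h) (k : ℕ) :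
    ((Real.log 2 : ℝ) : EReal) ≤ productEntropy (lipSeminorm ℓ k) (inducedAut catAut) := by
  classical
  let Ω : Finset (reducedCStar FlipGroup) := {groupElement 1, groupElement (translation ![1, 0])}
  have hΩ : ∀ a ∈ Ω, lipSeminorm ℓ k a < ⊤ ∧ ‖a‖ ≤ 1 := by
    intro a ha
    rcases Finset.mem_insert.1 ha with rfl | ha
    · exact ⟨lipSeminorm_groupElement_lt_top hℓ k _, norm_groupElement_le _⟩
    · rw [Finset.mem_singleton.1 ha]
      exact ⟨lipSeminorm_groupElement_lt_top hℓ k _, norm_groupElement_le _⟩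
  refine le_trans ?_ (le_iSup₂_of_le Ω hΩ (le_iSup₂_of_le (1 / 2 : ℝ) (by norm_num) le_rfl))
  refine log_le_limsup_log_div (c := 1 / 2) (by norm_num) (by norm_num) fun n => ?_
  let e (w : List.Vector Bool n) : FlipGroup := translation (catSum w.1)
  have he : Function.Injective e := by
    intro v w hvw
    by_contra hne
    have h := one_le_abs_eigenFunctional_sub (v.2.trans w.2.symm)
      fun h => hne (Subtype.ext h)
    rw [translation_injective hvw, sub_self, abs_zero] at h
    exact absurd h (by norm_num)
  have h := natCeil_half_card_le_approxDim (Finset.univ.image e)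
    (Y := orbitProduct (inducedAut catAut) (Ω : Set (reducedCStar FlipGroup)) n) <| by
      intro g hg
      obtain ⟨w, -, rfl⟩ := Finset.mem_image.1 hg
      have := groupElement_catSum_mem (Ω := (Ω : Set (reducedCStar FlipGroup)))
        (by simp [Ω]) (by simp [Ω]) w.1
      rwa [w.2] at this
  rw [Finset.card_image_of_injective _ he, Finset.card_univ, card_vector, Fintype.card_bool] at h
  refine le_trans ?_ (ENat.toENNReal_le.2 h)
  rw [ENat.toENNReal_coe, ← ENNReal.ofReal_natCast]
  refine ENNReal.ofReal_le_ofReal ((Nat.le_ceil _).trans' ?_)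
  push_cast
  rfl

end FlipGroup

theorem mainTheorem1 (S : Set FlipGroup) (hfin : S.Finite) (hS : Subgroup.closure S = ⊤) :
    (∃ g h : FlipGroup, g * h ≠ h * g) ∧
    (∃ H : Subgroup FlipGroup, H.FiniteIndex ∧ ∀ g ∈ H, ∀ h ∈ H, g * h = h * g) ∧
    ∀ k : ℕ, 1 ≤ k →
      ((Real.log 2 : ℝ) : EReal)
        ≤ productEntropy (lipSeminorm (wordLength S) k) (inducedAut catAut) ∧
      productEntropy (lipSeminorm (wordLength S) k) (inducedAut catAut)
        ≤ ((3 * Real.log 3 : ℝ) : EReal) ∧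
      0 < productEntropy (lipSeminorm (wordLength S) k) (inducedAut catAut) ∧
      productEntropy (lipSeminorm (wordLength S) k) (inducedAut catAut) < ⊤ := by
  refine ⟨FlipGroup.exists_not_commute, FlipGroup.exists_finiteIndex_commute, fun k _ => ?_⟩
  have hlow := FlipGroup.le_productEntropy (wordLength_mul_le hS) k
  have hup := FlipGroup.productEntropy_le (wordLength S) k
  refine ⟨hlow, hup, lt_of_lt_of_le ?_ hlow, hup.trans_lt (EReal.coe_lt_top _)⟩
  exact_mod_cast Real.log_pos (by norm_num)
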